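/- Let $F$ be a field of characteristic $2$. A quasilinear quadratic form over $F$ is a quadratic form $q\colon V\to F$ on a finite-dimensional $F$-vector space $V$ with $q(v+w)=q(v)+q(w)$ for all $v,w\in V$; put $\dim q=\dim_F V$. It is isotropic if $q(v)=0$ for some $v\neq 0$, and anisotropic otherwise. Its isotropy index $\mathfrak{i}_0(q)$ is the maximal dimension of a subspace of $V$ on which $q$ vanishes, and its anisotropic part $q_{\mathrm{an}}$ is the form induced by $q$ on $V/\{v\in V : q(v)=0\}$. For a field extension $L/F$, $q_L$ denotes the scalar extension of $q$ to $L\otimes_F V$, determined by $q_L(l\otimes v)=l^2q(v)$. The tensor product $p\otimes q$ of quasilinear forms is the quasilinear form with $(p\otimes q)(v\otimes w)=p(v)q(w)$, and $q$ is divisible by $p$ if $q\simeq p\otimes r$ for some quasilinear form $r$. For $a_1,\dots,a_n\in F^*$ $(n\ge 0)$, the $n$-fold quasi-Pfister form $\langle\!\langle a_1,\dots,a_n\rangle\!\rangle$ is $\langle 1,-a_1\rangle\otimes\cdots\otimes\langle 1,-a_n\rangle$, of dimension $2^n$ (it is $\langle 1\rangle$ for $n=0$). For an anisotropic quasilinear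 form $p$ of dimension $\geq 2$ over $F$, let $F(p)$ be the function field of the projective quadric $\{p=0\}$, let $p_1=(p_{F(p)})_{\mathrm{an}}$, and let $\mathfrak{d}_1(p)$ be the largest integer $s\ge 0$ such that $p_1$ is divisible by an $s$-fold quasi-Pfister form over $F(p)$. **Theorem 6.8.** Let $p$ and $q$ be anisotropic quasilinear quadratic forms of dimension $\geq 2$ over $F$ such that $q_{F(p)}$ is isotropic. If $\mathfrak{i}_0(q_{F(p)})>\dim q-\dim p$, then $$2^{\mathfrak{d}_1(p)}\geq \mathfrak{i}_0(q_{F(p)}).$$ In other words, under these hypotheses $p_1$ is divisible by a quasi-Pfister form over $F(p)$ of dimension at least $\mathfrak{i}_0(q_{F(p)})$. -/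

import Mathlib

open scoped TensorProduct

universe u v w

noncomputable section

/-- A quasilinear quadratic form on the `F`-vector space `V`: a quadratic form `q` such that
`q (v + w) = q v + q w` for all `v`, `w`. -/
structure QuasilinearForm (F : Type u) (V : Type v) [Field F] [AddCommGroup V] [Module F V] where
  /-- The underlying quadratic form. -/
  toQuadraticForm : QuadraticForm F V
  map_add' : ∀ v w : V, toQuadraticForm (v + w) = toQuadraticForm v + toQuadraticForm w

namespace QuasilinearForm

section General

variable {F : Type u} [Field F] {V : Type v} [AddCommGroup V] [Module F V]
  {W : Type w} [AddCommGroup W] [Module F W]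

instance : CoeFun (QuasilinearForm F V) (fun _ => V → F) where
  coe q := ⇑q.toQuadraticForm

theorem map_add (q : QuasilinearForm F V) (x y : V) : q (x + y) = q x + q y :=
  q.map_add' x y

theorem map_smul (q : QuasilinearForm F V) (a : F) (x : V) : q (a • x) = a * a * q x :=
  QuadraticMap.map_smul q.toQuadraticForm a x

theorem map_zero (q : QuasilinearForm F V) : q 0 = 0 :=
  QuadraticMap.map_zero q.toQuadraticForm

theorem map_neg (q : QuasilinearForm F V) (x : V) : q (-x) = q x :=
  QuadraticMap.map_neg q.toQuadraticForm x

theorem apply_add_apply_self (q : QuasilinearForm F V) (x : V) : q x + q x = 0 := by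
  have h := q.map_add x (-x)
  rw [add_neg_cancel, q.map_zero, q.map_neg] at h
  exact h.symm

/-- The quasilinear form given by an additive map `f` with `f (a • x) = a ^ 2 * f x`. -/
def ofAddMonoidHom (f : V →+ F) (hf : ∀ (a : F) (x : V), f (a • x) = a * a * f x) :
    QuasilinearForm F V where
  toQuadraticForm :=
    { toFun := f
      toFun_smul := fun a x => by simpa using hf a x
      exists_companion' := ⟨0, fun x y => by simp⟩ }
  map_add' := fun x y => by simp

theorem ofAddMonoidHom_apply (f : V →+ F) (hf : ∀ (a : F) (x : V), f (a • x) = a * a * f x)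
    (x : V) : ofAddMonoidHom f hf x = f x := rfl

/-- The dimension of a form is the dimension of the space on which it is defined. -/
def dim (_q : QuasilinearForm F V) : ℕ := Module.finrank F V

/-- `q` is anisotropic if `0` is its only isotropic vector. -/
def IsAnisotropic (q : QuasilinearForm F V) : Prop := q.toQuadraticForm.Anisotropic

/-- `q` is isotropic if it has a non-zero isotropic vector. -/
def IsIsotropic (q : QuasilinearForm F V) : Prop := ∃ x : V, x ≠ 0 ∧ q x = 0

/-- Isometry of forms: a linear isomorphism of the underlying spaces that respects the forms. -/
def IsIsometric (p : QuasilinearForm F V) (q : QuasilinearForm F W) : Prop :=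
  p.toQuadraticForm.Equivalent q.toQuadraticForm

/-- The isotropy index: the maximal dimension of a totally isotropic subspace. -/
def isotropyIndex (q : QuasilinearForm F V) : ℕ :=
  sSup {n : ℕ | ∃ U : Submodule F V, (∀ x ∈ U, q x = 0) ∧ Module.finrank F U = n}

/-- The subspace of all isotropic vectors of a quasilinear form. -/
def isotropicSubspace (q : QuasilinearForm F V) : Submodule F V where
  carrier := {x | q x = 0}
  zero_mem' := q.map_zero
  add_mem' := fun {x y} hx hy => by
    change q (x + y) = 0
    rw [q.map_add, show q x = 0 from hx, show q y = 0 from hy, add_zero]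
  smul_mem' := fun a x hx => by
    change q (a • x) = 0
    rw [q.map_smul, show q x = 0 from hx, mul_zero]

theorem isotropicSubspace_le_radical (q : QuasilinearForm F V) :
    q.isotropicSubspace ≤ q.toQuadraticForm.radical := by
  intro x hx
  rw [QuadraticMap.mem_radical_iff']
  have hx' : q x = 0 := hx
  exact ⟨hx', fun n => by rw [q.map_add', hx', zero_add]⟩

/-- The anisotropic part of `q`: the form that `q` induces on the quotient of its space by the
subspace of isotropic vectors. -/
def anisotropicPart (q : QuasilinearForm F V) : QuasilinearForm F (V ⧸ q.isotropicSubspace) where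
  toQuadraticForm := q.toQuadraticForm.lift q.isotropicSubspace q.isotropicSubspace_le_radical
  map_add' := by
    intro x y
    induction x using Submodule.Quotient.induction_on with | H x => ?_
    induction y using Submodule.Quotient.induction_on with | H y => ?_
    exact q.map_add x y

theorem anisotropicPart_mk (q : QuasilinearForm F V) (x : V) :
    q.anisotropicPart (Submodule.Quotient.mk x) = q x := rfl

/-- The tensor product of two quasilinear forms: the quasilinear form on `V ⊗ W` (its polar form
is zero, like those of `p` and `q`) with `v ⊗ w ↦ p v * q w`. -/
def tmul (p : QuasilinearForm F V) (q : QuasilinearForm F W) : QuasilinearForm F (V ⊗[F] W) :=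
  let f : V ⊗[F] W →+ F := TensorProduct.liftAddHom
    (AddMonoidHom.mk' (fun x => AddMonoidHom.mk' (fun y => p x * q y)
      (fun y y' => by rw [q.map_add, mul_add]))
      (fun x x' => by ext y; simp [p.map_add, add_mul]))
    (fun a x y => by simp only [AddMonoidHom.mk'_apply, p.map_smul, q.map_smul]; ring)
  ofAddMonoidHom f (fun a t => by
    induction t with
    | zero => simp
    | tmul x y => simp [f, TensorProduct.smul_tmul', p.map_smul]; ring
    | add s t hs ht => rw [smul_add, _root_.map_add, _root_.map_add, hs, ht, mul_add])

theorem tmul_tmul (p : QuasilinearForm F V) (q : QuasilinearForm F W) (x : V) (y : W) :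
    p.tmul q (x ⊗ₜ[F] y) = p x * q y := rfl

/-- Scalar extension: the quasilinear form `q_L` on `L ⊗ V` that extends `q`, i.e. the one with
`l ⊗ v ↦ l ^ 2 * q v`. -/
def baseChange (L : Type w) [Field L] [Algebra F L] (q : QuasilinearForm F V) :
    QuasilinearForm L (L ⊗[F] V) :=
  let f : L ⊗[F] V →+ L := TensorProduct.liftAddHom
    (AddMonoidHom.mk' (fun l => AddMonoidHom.mk' (fun x => l * l * algebraMap F L (q x))
      (fun x y => by rw [q.map_add, _root_.map_add, mul_add]))
      (fun l l' => by
        ext x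
        have h : algebraMap F L (q x) + algebraMap F L (q x) = 0 := by
          rw [← _root_.map_add, q.apply_add_apply_self, _root_.map_zero]
        simp only [AddMonoidHom.mk'_apply, AddMonoidHom.add_apply]
        linear_combination l * l' * h))
    (fun a l x => by
      simp only [AddMonoidHom.mk'_apply, q.map_smul, Algebra.smul_def, _root_.map_mul]; ring)
  ofAddMonoidHom f (fun a t => by
    induction t with
    | zero => simp
    | tmul l x => simp [f, TensorProduct.smul_tmul']; ring
    | add s t hs ht => rw [smul_add, _root_.map_add, _root_.map_add, hs, ht, mul_add])

theorem baseChange_tmul (L : Type w) [Field L] [Algebra F L] (q : QuasilinearForm F V)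
    (l : L) (x : V) : q.baseChange L (l ⊗ₜ[F] x) = l * l * algebraMap F L (q x) := rfl

/-- `q` is divisible by `p` if `q ≃ p ⊗ r` for some form `r`; up to isometry, `r` lives on some
`F ^ m`. -/
def IsDivisibleBy (q : QuasilinearForm F V) (p : QuasilinearForm F W) : Prop :=
  ∃ (m : ℕ) (r : QuasilinearForm F (Fin m → F)), q.IsIsometric (p.tmul r)

end General

section Pfister

variable (F : Type u) [Field F] [CharP F 2]

/-- The diagonal form `⟨a_1, …, a_n⟩` over a field of characteristic `2`. -/
def diagonal {n : ℕ} (a : Fin n → F) : QuasilinearForm F (Fin n → F) :=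
  ofAddMonoidHom
    (AddMonoidHom.mk' (fun x => ∑ i, a i * x i ^ 2) (fun x y => by
      rw [← Finset.sum_add_distrib]
      exact Finset.sum_congr rfl fun i _ => by rw [Pi.add_apply, CharTwo.add_sq, mul_add]))
    (fun c x => by
      simp only [AddMonoidHom.mk'_apply, Pi.smul_apply, smul_eq_mul, Finset.mul_sum]
      exact Finset.sum_congr rfl fun i _ => by ring)

/-- The one-dimensional form `⟨1⟩` on `F`, i.e. `x ↦ x ^ 2`. -/
def one : QuasilinearForm F F :=
  ofAddMonoidHom (AddMonoidHom.mk' (fun x => x ^ 2) CharTwo.add_sq)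
    (fun c x => by simp only [AddMonoidHom.mk'_apply, smul_eq_mul]; ring)

/-- A quasilinear form together with the space on which it is defined. -/
structure Bundled (F : Type u) [Field F] where
  /-- The underlying space. -/
  space : Type u
  [addCommGroup : AddCommGroup space]
  [module : Module F space]
  /-- The form. -/
  form : QuasilinearForm F space

attribute [instance] Bundled.addCommGroup Bundled.module

variable {F} in
/-- The quasi-Pfister form `⟨⟨a_1, …, a_n⟩⟩ = ⟨1, -a_1⟩ ⊗ ⋯ ⊗ ⟨1, -a_n⟩` attached to a list of
non-zero scalars; for the empty list (the `0`-fold case) it is `⟨1⟩`. -/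
def quasiPfister : List Fˣ → Bundled F
  | [] => ⟨F, one F⟩
  | a :: l => ⟨(Fin 2 → F) ⊗[F] (quasiPfister l).space,
      (diagonal F ![1, -(a : F)]).tmul (quasiPfister l).form⟩

variable {F} in
/-- The divisibility index of `q`: the largest `s` such that the anisotropic part of `q` is
divisible by an `s`-fold quasi-Pfister form. -/
def divisibilityIndex {V : Type v} [AddCommGroup V] [Module F V] (q : QuasilinearForm F V) : ℕ :=
  sSup {s : ℕ | ∃ l : List Fˣ, l.length = s ∧
    q.anisotropicPart.IsDivisibleBy (quasiPfister l).form}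

end Pfister

section FunctionField

variable {F : Type u} [Field F] {V : Type v} [AddCommGroup V] [Module F V] [Module.Finite F V]

/-- The form `p` written as a homogeneous polynomial of degree `2` in the coordinates with respect
to a basis of `V`. -/
def polynomial (p : QuasilinearForm F V) : MvPolynomial (Fin (Module.finrank F V)) F :=
  ∑ i, MvPolynomial.C (p (Module.finBasis F V i)) * MvPolynomial.X i ^ 2

theorem eval_polynomial (p : QuasilinearForm F V) (x : Fin (Module.finrank F V) → F) :
    MvPolynomial.eval x p.polynomial = p (∑ i, x i • Module.finBasis F V i) := by
  have h : ∀ s : Finset (Fin (Module.finrank F V)),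
      p (∑ i ∈ s, x i • Module.finBasis F V i) =
        ∑ i ∈ s, x i * x i * p (Module.finBasis F V i) := by
    intro s
    classical
    induction s using Finset.induction_on with
    | empty => simp
    | insert i s hi ih => rw [Finset.sum_insert hi, Finset.sum_insert hi, p.map_add, p.map_smul, ih]
  rw [h, polynomial, _root_.map_sum]
  refine Finset.sum_congr rfl fun i _ => ?_
  simp only [_root_.map_mul, MvPolynomial.eval_C, map_pow, MvPolynomial.eval_X]
  ring

theorem polynomial_isHomogeneous (p : QuasilinearForm F V) : p.polynomial.IsHomogeneous 2 := by
  refine MvPolynomial.IsHomogeneous.sum _ _ _ fun i _ => ?_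
  exact ((MvPolynomial.isHomogeneous_X F i).pow 2).C_mul (p (Module.finBasis F V i))

theorem exists_linearMap_eval {ι : Type*} [Fintype ι] {A : MvPolynomial ι F}
    (hA : A.IsHomogeneous 1) :
    ∃ l : (ι → F) →ₗ[F] F, ∀ x, MvPolynomial.eval x A = l x := by
  have h : A ∈ Submodule.span F (Set.range (MvPolynomial.X : ι → MvPolynomial ι F)) := by
    rw [← MvPolynomial.homogeneousSubmodule_one_eq_span_X]
    exact hA
  clear hA
  induction h using Submodule.span_induction with
  | mem _ h =>
    obtain ⟨i, rfl⟩ := h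
    exact ⟨LinearMap.proj i, fun x => by simp⟩
  | zero => exact ⟨0, fun x => by simp⟩
  | add _ _ _ _ h₁ h₂ =>
    obtain ⟨l₁, h₁⟩ := h₁
    obtain ⟨l₂, h₂⟩ := h₂
    exact ⟨l₁ + l₂, fun x => by simp [h₁, h₂]⟩
  | smul a _ _ h =>
    obtain ⟨l, h⟩ := h
    exact ⟨a • l, fun x => by simp [h]⟩

theorem polynomial_irreducible (p : QuasilinearForm F V) (hp : p.IsAnisotropic)
    (hdim : 2 ≤ p.dim) : Irreducible p.polynomial := by
  have hne : ∀ x, MvPolynomial.eval x p.polynomial = 0 → x = 0 := by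
    intro x hx
    rw [eval_polynomial] at hx
    have h := hp _ hx
    exact funext (Fintype.linearIndependent_iff.1 (Module.finBasis F V).linearIndependent x h)
  have h0 : p.polynomial ≠ 0 := by
    intro h
    have := hne (fun _ => 1) (by rw [h, _root_.map_zero])
    exact one_ne_zero (congrFun this ⟨0, by unfold dim at hdim; omega⟩)
  have hdeg : p.polynomial.totalDegree = 2 := p.polynomial_isHomogeneous.totalDegree h0
  have hunit : ∀ A : MvPolynomial (Fin (Module.finrank F V)) F, A ≠ 0 → A.totalDegree = 0 →
      IsUnit A := by
    intro A hA h
    rw [MvPolynomial.totalDegree_eq_zero_iff_eq_C] at h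
    rw [h] at hA ⊢
    exact (IsUnit.mk0 _ (by rintro h'; exact hA (by rw [h', MvPolynomial.C_0]))).map MvPolynomial.C
  refine ⟨fun hu => ?_, fun A B hAB => ?_⟩
  · rw [MvPolynomial.isUnit_iff_totalDegree_of_isReduced, hdeg] at hu
    exact absurd hu.2 (by norm_num)
  have hA0 : A ≠ 0 := by rintro rfl; exact h0 (by rw [hAB, zero_mul])
  have hB0 : B ≠ 0 := by rintro rfl; exact h0 (by rw [hAB, mul_zero])
  have hsum : A.totalDegree + B.totalDegree = 2 := by
    rw [← MvPolynomial.totalDegree_mul_of_isDomain hA0 hB0, ← hAB, hdeg]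
  by_contra hcon
  rw [not_or] at hcon
  have hA : A.totalDegree ≠ 0 := fun h => hcon.1 (hunit A hA0 h)
  have hB : B.totalDegree ≠ 0 := fun h => hcon.2 (hunit B hB0 h)
  have hdec : ∀ C : MvPolynomial (Fin (Module.finrank F V)) F, C.totalDegree = 1 →
      C = MvPolynomial.homogeneousComponent 0 C + MvPolynomial.homogeneousComponent 1 C := by
    intro C hC
    conv_lhs => rw [← MvPolynomial.sum_homogeneousComponent C, hC]
    simp [Finset.sum_range_succ]
  have hc := MvPolynomial.homogeneousComponent_isHomogeneous (σ := Fin (Module.finrank F V)) (R := F)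
  have e : p.polynomial =
      MvPolynomial.homogeneousComponent 1 A * MvPolynomial.homogeneousComponent 1 B := by
    have h := congrArg (MvPolynomial.homogeneousComponent 2) hAB
    rw [hdec A (by omega), hdec B (by omega), add_mul, mul_add, mul_add] at h
    simp only [_root_.map_add] at h
    rw [MvPolynomial.homogeneousComponent_of_mem p.polynomial_isHomogeneous,
      MvPolynomial.homogeneousComponent_of_mem ((hc 0 A).mul (hc 0 B)),
      MvPolynomial.homogeneousComponent_of_mem ((hc 0 A).mul (hc 1 B)),
      MvPolynomial.homogeneousComponent_of_mem ((hc 1 A).mul (hc 0 B)),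
      MvPolynomial.homogeneousComponent_of_mem ((hc 1 A).mul (hc 1 B))] at h
    simpa using h
  obtain ⟨l, hl⟩ := exists_linearMap_eval (hc 1 A)
  have hker : LinearMap.ker l ≠ ⊥ := by
    apply LinearMap.ker_ne_bot_of_finrank_lt
    unfold dim at hdim
    simp
    omega
  obtain ⟨x, hx, hx0⟩ := Submodule.exists_mem_ne_zero_of_ne_bot hker
  refine hx0 (hne x ?_)
  rw [e, _root_.map_mul, hl, LinearMap.mem_ker.1 hx, zero_mul]

open Classical in
/-- The ideal of the affine cone `{p = 0}`. It is the principal ideal generated by the polynomial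
of `p` whenever that ideal is prime, in particular for all anisotropic `p` of dimension at least
`2`, see `coneIdeal_eq` below; in the other cases (where the function field of the quadric is not
defined) it has the dummy value `⊥`. -/
def coneIdeal (p : QuasilinearForm F V) : Ideal (MvPolynomial (Fin (Module.finrank F V)) F) :=
  if (Ideal.span {p.polynomial}).IsPrime then Ideal.span {p.polynomial} else ⊥

instance coneIdeal_isPrime (p : QuasilinearForm F V) : p.coneIdeal.IsPrime := by
  unfold coneIdeal
  split_ifs with h
  · exact h
  · exact Ideal.isPrime_bot

theorem coneIdeal_eq (p : QuasilinearForm F V) (hp : p.IsAnisotropic) (hdim : 2 ≤ p.dim) :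
    p.coneIdeal = Ideal.span {p.polynomial} := by
  have h := p.polynomial_irreducible hp hdim
  exact if_pos ((Ideal.span_singleton_prime h.ne_zero).2 h.prime)

/-- The homogeneous coordinate ring of the quadric `{p = 0}`. -/
abbrev CoordinateRing (p : QuasilinearForm F V) : Type u :=
  MvPolynomial (Fin (Module.finrank F V)) F ⧸ p.coneIdeal

/-- The function field `F[p]` of the affine cone `{p = 0}`. -/
def ConeFunctionField (p : QuasilinearForm F V) : Type u := FractionRing p.CoordinateRing

instance (p : QuasilinearForm F V) : Field p.ConeFunctionField :=
  inferInstanceAs (Field (FractionRing p.CoordinateRing))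

instance (p : QuasilinearForm F V) : Algebra p.CoordinateRing p.ConeFunctionField :=
  inferInstanceAs (Algebra p.CoordinateRing (FractionRing p.CoordinateRing))

instance (p : QuasilinearForm F V) : IsFractionRing p.CoordinateRing p.ConeFunctionField :=
  inferInstanceAs (IsFractionRing p.CoordinateRing (FractionRing p.CoordinateRing))

instance (p : QuasilinearForm F V) : Algebra F p.ConeFunctionField :=
  inferInstanceAs (Algebra F (FractionRing p.CoordinateRing))

instance (p : QuasilinearForm F V) : IsScalarTower F p.CoordinateRing p.ConeFunctionField :=
  inferInstanceAs (IsScalarTower F p.CoordinateRing (FractionRing p.CoordinateRing))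

/-- The `i`-th coordinate function, as an element of `F[p]`. -/
def coordinate (p : QuasilinearForm F V) (i : Fin (Module.finrank F V)) : p.ConeFunctionField :=
  algebraMap p.CoordinateRing p.ConeFunctionField (Ideal.Quotient.mk p.coneIdeal (MvPolynomial.X i))

/-- The function field `F(p)` of the projective quadric `{p = 0}`, as a subfield of `F[p]`: it is
generated over `F` by the ratios of the homogeneous coordinates. -/
def functionSubfield (p : QuasilinearForm F V) : IntermediateField F p.ConeFunctionField :=
  IntermediateField.adjoin F {z | ∃ i j, z = p.coordinate i / p.coordinate j}

/-- The function field `F(p)` of the projective quadric `{p = 0}`. -/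
def FunctionField (p : QuasilinearForm F V) : Type u := p.functionSubfield

instance (p : QuasilinearForm F V) : Field p.FunctionField :=
  inferInstanceAs (Field p.functionSubfield)

instance (p : QuasilinearForm F V) : Algebra F p.FunctionField :=
  inferInstanceAs (Algebra F p.functionSubfield)

instance (p : QuasilinearForm F V) [CharP F 2] : CharP p.FunctionField 2 :=
  charP_of_injective_algebraMap (algebraMap F p.FunctionField).injective 2

/-- The form `p_1 = (p_{F(p)})_an` attached to an anisotropic form `p` of dimension at least `2`
(which is its own `0`-th kernel form `p_0`). -/
def firstKernel (p : QuasilinearForm F V) :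
    QuasilinearForm p.FunctionField
      ((p.FunctionField ⊗[F] V) ⧸ (p.baseChange p.FunctionField).isotropicSubspace) :=
  (p.baseChange p.FunctionField).anisotropicPart

/-- The first higher divisibility index `𝔡_1(p)`, the divisibility index of `p_1`. -/
def firstDivisibilityIndex [CharP F 2] (p : QuasilinearForm F V) : ℕ :=
  p.firstKernel.divisibilityIndex

end FunctionField

end QuasilinearForm

end

/-!
Let `K ^ 2` be the subfield of squares of a field `K` of characteristic `2`. The values of a
quasilinear form `q` over `K` form a `K ^ 2`-subspace `D(q)` of `K` of dimension `dim q - i₀(q)`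
(`finrank_valueSpace_add_isotropyIndex`), and `D(q)` determines the anisotropic part of `q`
(`isIsometric_of_valueSpace_eq`). The scalars `x` with `x D(q) ⊆ D(q)` form a field `E`. It is the set
of values of an anisotropic quasi-Pfister form (`exists_quasiPfister_valueSpace_eq`), and this form
divides `q_an` because `D(q)` has a basis over `E`
(`isDivisibleBy_of_valueSpace_eq_multiplierField`). So the theorem says that the multiplier field `E`
of `P = D(p_L)`, where `L = F(p)`, has dimension at least `i₀(q_L)` over `L ^ 2`.

Let `u` be an isotropic vector of `q` over `L`. After clearing denominators, `u` is a vector of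
polynomials with `q(u) = p g`. As `p(X + Y eᵢ) = p(X) + Y ^ 2 p(eᵢ)`, the terms of degree `2` in `Y`
of this equation at `X + Y eᵢ` give `q(∂u / ∂Xᵢ) = p(eᵢ) g` on the quadric
(`sum_coneDerivation_sq_of_eq_mul`). Hence `g P ⊆ Q`, where `Q = D(q_L)`
(`isotropyMultiplier_mul_mem`). If `g` vanishes on the quadric, then `q(u) = p ^ 2 h`, and then `p`
divides `u`, as the coefficients of `q` are linearly independent over `F ^ 2`
(`sq_dvd_of_sq_dvd_sum`). So `u ↦ g` is an anisotropic quasilinear form on the space of isotropic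
vectors, and its values form an `L ^ 2`-space `N` of dimension `i₀(q_L)` with `N P ⊆ Q`.

For `q = p` this says `N ⊆ E`, so `i₀(p_L) ≤ [E : L ^ 2]`. For general `q`, the hypothesis on the
index becomes `dim Q < dim p = dim P + i₀(p_L) ≤ dim P + [E : L ^ 2]`. Then there is no room in `Q` for
a line `E y z` outside `x P` with `x, y ∈ N` and `z ∈ P`, so that all `x P` with `0 ≠ x ∈ N` are equal
and `N` lies in a multiple of `E` (`finrank_le_finrank_multiplierField`).
-/

noncomputable section

namespace QuasilinearForm

/-! ### Spaces of values -/

section Values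

variable {K : Type u} [Field K] {V : Type v} [AddCommGroup V] [Module K V]
  {W : Type w} [AddCommGroup W] [Module K W]

variable (K) in
/-- The subfield `K ^ 2` of squares of a field of characteristic `2`. -/
abbrev squares [CharP K 2] : Subfield K := (frobenius K 2).fieldRange

theorem mul_self_mem_squares [CharP K 2] (a : K) : a * a ∈ squares K :=
  ⟨a, by rw [frobenius_def, sq]⟩

theorem exists_mul_self_eq [CharP K 2] (c : squares K) : ∃ a : K, (c : K) = a * a := by
  obtain ⟨_, a, rfl⟩ := c
  exact ⟨a, by simp [frobenius_def, sq]⟩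

/-- A quasilinear form as an additive map. -/
def toAddMonoidHom (q : QuasilinearForm K V) : V →+ K := AddMonoidHom.mk' q q.map_add

theorem map_sub (q : QuasilinearForm K V) (x y : V) : q (x - y) = q x - q y :=
  _root_.map_sub q.toAddMonoidHom x y

theorem map_sum (q : QuasilinearForm K V) {ι : Type*} (s : Finset ι) (f : ι → V) :
    q (∑ i ∈ s, f i) = ∑ i ∈ s, q (f i) :=
  _root_.map_sum q.toAddMonoidHom f s

theorem IsAnisotropic.injective {q : QuasilinearForm K V} (hq : q.IsAnisotropic) :
    Function.Injective q := fun x y h =>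
  sub_eq_zero.1 (hq _ ((q.map_sub x y).trans (sub_eq_zero.2 h)))

theorem anisotropicPart_isAnisotropic (q : QuasilinearForm K V) :
    q.anisotropicPart.IsAnisotropic := by
  intro x hx
  induction x using Submodule.Quotient.induction_on with | H x => ?_
  exact (Submodule.Quotient.mk_eq_zero _).2 hx

theorem isotropyIndex_eq_finrank [Module.Finite K V] (q : QuasilinearForm K V) :
    q.isotropyIndex = Module.finrank K q.isotropicSubspace := by
  refine IsGreatest.csSup_eq ⟨⟨_, fun x hx => hx, rfl⟩, ?_⟩
  rintro _ ⟨U, hU, rfl⟩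
  exact Submodule.finrank_mono hU

variable [CharP K 2]

/-- The set of values of `q`, as a vector space over the subfield of squares. -/
def valueSpace (q : QuasilinearForm K V) : Submodule (squares K) K where
  carrier := Set.range q
  zero_mem' := ⟨0, q.map_zero⟩
  add_mem' := by
    rintro _ _ ⟨x, rfl⟩ ⟨y, rfl⟩
    exact ⟨x + y, q.map_add x y⟩
  smul_mem' := by
    rintro c _ ⟨x, rfl⟩
    obtain ⟨a, ha⟩ := exists_mul_self_eq c
    exact ⟨a • x, by rw [q.map_smul, Subfield.smul_def, ha, smul_eq_mul]⟩

theorem mem_valueSpace {q : QuasilinearForm K V} {y : K} : y ∈ q.valueSpace ↔ ∃ x, q x = y :=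
  Iff.rfl

theorem apply_mem_valueSpace (q : QuasilinearForm K V) (x : V) : q x ∈ q.valueSpace := ⟨x, rfl⟩

/-- The Frobenius, as an isomorphism of a field with its subfield of squares. -/
def squaresEquiv : K ≃+* squares K :=
  RingEquiv.ofBijective (frobenius K 2).rangeRestrictField
    ⟨(frobenius K 2).rangeRestrictField.injective,
      (frobenius K 2).rangeRestrictField_bijective.2⟩

theorem squaresEquiv_apply (a : K) : (squaresEquiv a : K) = a * a := by
  change frobenius K 2 a = _
  rw [frobenius_def, sq]

theorem lift_rank_valueSpace {q : QuasilinearForm K V} (hq : q.IsAnisotropic) :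
    Cardinal.lift.{u} (Module.rank K V) =
      Cardinal.lift.{v} (Module.rank (squares K) q.valueSpace) := by
  let j : V ≃+ q.valueSpace := AddEquiv.ofBijective
    (AddMonoidHom.mk' (fun x => (⟨q x, q.apply_mem_valueSpace x⟩ : q.valueSpace))
      (fun x y => Subtype.ext (q.map_add x y)))
    ⟨fun x y h => hq.injective (congrArg Subtype.val h), fun ⟨y, x, hx⟩ => ⟨x, Subtype.ext hx⟩⟩
  refine lift_rank_eq_of_equiv_equiv squaresEquiv j squaresEquiv.bijective fun a x => ?_
  apply Subtype.ext
  rw [Submodule.coe_smul, Subfield.smul_def, squaresEquiv_apply, smul_eq_mul]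
  exact q.map_smul a x

theorem finrank_valueSpace {q : QuasilinearForm K V} (hq : q.IsAnisotropic) :
    Module.finrank (squares K) q.valueSpace = Module.finrank K V := by
  have h := congrArg Cardinal.toNat (lift_rank_valueSpace hq)
  simpa [Module.finrank] using h.symm

theorem valueSpace_anisotropicPart (q : QuasilinearForm K V) :
    q.anisotropicPart.valueSpace = q.valueSpace := by
  ext y
  constructor
  · rintro ⟨x, rfl⟩
    induction x using Submodule.Quotient.induction_on with | H x => ?_
    exact ⟨x, rfl⟩
  · rintro ⟨x, rfl⟩
    exact ⟨Submodule.Quotient.mk x, rfl⟩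

instance finite_valueSpace [Module.Finite K V] (q : QuasilinearForm K V) :
    Module.Finite (squares K) q.valueSpace := by
  rw [← valueSpace_anisotropicPart, ← Module.rank_lt_aleph0_iff]
  have h := lift_rank_valueSpace q.anisotropicPart_isAnisotropic
  have h' : Module.rank K (V ⧸ q.isotropicSubspace) < Cardinal.aleph0 :=
    Module.rank_lt_aleph0 K _
  rw [← Cardinal.lift_lt_aleph0.{_, v}, ← h, Cardinal.lift_lt_aleph0]
  exact h'

theorem finrank_valueSpace_add_isotropyIndex [Module.Finite K V] (q : QuasilinearForm K V) :
    Module.finrank (squares K) q.valueSpace + q.isotropyIndex = Module.finrank K V := by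
  rw [isotropyIndex_eq_finrank, ← valueSpace_anisotropicPart,
    finrank_valueSpace q.anisotropicPart_isAnisotropic, Submodule.finrank_quotient_add_finrank]

/-- Anisotropic quasilinear forms are determined by their values. -/
theorem isIsometric_of_valueSpace_eq {p : QuasilinearForm K V} {q : QuasilinearForm K W}
    (hp : p.IsAnisotropic) (hq : q.IsAnisotropic) (h : p.valueSpace = q.valueSpace) :
    p.IsIsometric q := by
  have h₁ : ∀ x, ∃ y, q y = p x := fun x =>
    mem_valueSpace.1 (h ▸ p.apply_mem_valueSpace x)
  have h₂ : ∀ y, ∃ x, p x = q y := fun y =>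
    mem_valueSpace.1 (h ▸ q.apply_mem_valueSpace y)
  choose f hf using h₁
  choose g hg using h₂
  exact ⟨{
    toFun := f
    map_add' := fun x y => hq.injective (by rw [q.map_add, hf, hf, hf, p.map_add])
    map_smul' := fun a x => hq.injective (by
      rw [RingHom.id_apply, q.map_smul, hf, hf, p.map_smul])
    invFun := g
    left_inv := fun x => hp.injective (by rw [hg, hf])
    right_inv := fun y => hq.injective (by rw [hf, hg])
    map_app' := hf }⟩

end Values

/-! ### Quasi-Pfister forms and multiplier fields -/

section Multiplier

variable {K : Type u} [Field K] [CharP K 2] {V : Type v} [AddCommGroup V] [Module K V]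
  {S : Type w} [AddCommGroup S] [Module K S]

theorem diagonal_single {n : ℕ} (a : Fin n → K) (i : Fin n) (x : K) :
    diagonal K a (Pi.single i x) = a i * x ^ 2 := by
  change ∑ j, a j * (Pi.single i x : Fin n → K) j ^ 2 = _
  rw [Finset.sum_eq_single i] <;> simp +contextual

theorem exists_tmul_diagonal_eq {n : ℕ} (a : Fin n → K) (q : QuasilinearForm K S)
    (t : S ⊗[K] (Fin n → K)) :
    ∃ s : Fin n → S, t = ∑ i, s i ⊗ₜ Pi.single i 1 ∧
      q.tmul (diagonal K a) t = ∑ i, q (s i) * a i := by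
  obtain ⟨b, rfl⟩ := TensorProduct.eq_repr_basis_right (Pi.basisFun K (Fin n)) t
  refine ⟨b, ?_, ?_⟩
  · rw [Finsupp.sum_fintype _ _ (by simp)]
    simp
  · rw [Finsupp.sum_fintype _ _ (by simp), map_sum]
    simp [tmul_tmul, diagonal_single]

theorem exists_diagonal_tmul_eq {n : ℕ} (a : Fin n → K) (q : QuasilinearForm K S)
    (t : (Fin n → K) ⊗[K] S) :
    ∃ s : Fin n → S, t = ∑ i, Pi.single i 1 ⊗ₜ s i ∧
      (diagonal K a).tmul q t = ∑ i, a i * q (s i) := by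
  obtain ⟨b, rfl⟩ := TensorProduct.eq_repr_basis_left (Pi.basisFun K (Fin n)) t
  refine ⟨b, ?_, ?_⟩
  · rw [Finsupp.sum_fintype _ _ (by simp)]
    simp
  · rw [Finsupp.sum_fintype _ _ (by simp), map_sum]
    simp [tmul_tmul, diagonal_single]

theorem one_isAnisotropic : (one K).IsAnisotropic := fun _ hx =>
  (pow_eq_zero_iff (M₀ := K) two_ne_zero).1 hx

theorem finrank_quasiPfister (l : List Kˣ) :
    Module.finrank K (quasiPfister l).space = 2 ^ l.length := by
  induction l with
  | nil => exact Module.finrank_self K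
  | cons a l ih =>
    change Module.finrank K ((Fin 2 → K) ⊗[K] (quasiPfister l).space) = _
    rw [Module.finrank_tensorProduct, ih, List.length_cons, pow_succ']
    simp

theorem mem_valueSpace_quasiPfister_cons (a : Kˣ) (l : List Kˣ) (y : K) :
    y ∈ (quasiPfister (a :: l)).form.valueSpace ↔
      ∃ s ∈ (quasiPfister l).form.valueSpace, ∃ t ∈ (quasiPfister l).form.valueSpace,
        y = s + a * t := by
  constructor
  · rintro ⟨x, rfl⟩
    obtain ⟨s, -, hs⟩ := exists_diagonal_tmul_eq ![1, -(a : K)] (quasiPfister l).form x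
    refine ⟨_, apply_mem_valueSpace _ (s 0), _, apply_mem_valueSpace _ (s 1), hs.trans ?_⟩
    simp [Fin.sum_univ_two, CharTwo.neg_eq]
  · rintro ⟨_, ⟨s, rfl⟩, _, ⟨t, rfl⟩, rfl⟩
    refine ⟨(Pi.single 0 1 : Fin 2 → K) ⊗ₜ s + (Pi.single 1 1 : Fin 2 → K) ⊗ₜ t, ?_⟩
    change (diagonal K ![1, -(a : K)]).tmul (quasiPfister l).form _ = _
    refine (QuasilinearForm.map_add _ _ _).trans ?_
    rw [tmul_tmul, tmul_tmul, diagonal_single, diagonal_single]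
    simp [CharTwo.neg_eq]

/-- The values of a quasi-Pfister form are closed under multiplication. -/
theorem mul_mem_valueSpace_quasiPfister (l : List Kˣ) {x y : K}
    (hx : x ∈ (quasiPfister l).form.valueSpace) (hy : y ∈ (quasiPfister l).form.valueSpace) :
    x * y ∈ (quasiPfister l).form.valueSpace := by
  induction l generalizing x y with
  | nil =>
    obtain ⟨(a : K), rfl⟩ := hx
    obtain ⟨(b : K), rfl⟩ := hy
    exact ⟨(a * b : K), mul_pow a b 2⟩
  | cons a l ih =>
    rw [mem_valueSpace_quasiPfister_cons] at hx hy ⊢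
    obtain ⟨s, hs, t, ht, rfl⟩ := hx
    obtain ⟨s', hs', t', ht', rfl⟩ := hy
    refine ⟨s * s' + a * a * (t * t'), add_mem (ih hs hs') ?_, s * t' + t * s',
      add_mem (ih hs ht') (ih ht hs'), by ring⟩
    exact Submodule.smul_mem _ (⟨_, mul_self_mem_squares (a : K)⟩ : squares K) (ih ht ht')

/-- Adjoining a scalar which is not a value keeps a quasi-Pfister form anisotropic. -/
theorem quasiPfister_cons_isAnisotropic {a : Kˣ} {l : List Kˣ}
    (hl : (quasiPfister l).form.IsAnisotropic)
    (ha : (a : K) ∉ (quasiPfister l).form.valueSpace) :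
    (quasiPfister (a :: l)).form.IsAnisotropic := by
  intro x hx
  obtain ⟨s, hs, hs'⟩ := exists_diagonal_tmul_eq ![1, -(a : K)] (quasiPfister l).form x
  have h : (quasiPfister l).form (s 0) + a * (quasiPfister l).form (s 1) = 0 := by
    have := hs'.symm.trans hx
    simpa [Fin.sum_univ_two, CharTwo.neg_eq] using this
  have h1 : s 1 = 0 := by
    by_contra hne
    have hv : (quasiPfister l).form (s 1) ≠ 0 := fun h0 => hne (hl _ h0)
    refine ha ?_
    -- `a = π(s₀) π(s₁) (π(s₁)⁻¹)²`
    have e : (a : K) = ((quasiPfister l).form (s 1))⁻¹ * ((quasiPfister l).form (s 1))⁻¹ *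
        ((quasiPfister l).form (s 0) * (quasiPfister l).form (s 1)) := by
      field_simp
      rw [← CharTwo.neg_eq ((quasiPfister l).form (s 0))]
      linear_combination h
    rw [e]
    exact Submodule.smul_mem _ (⟨_, mul_self_mem_squares _⟩ : squares K)
      (mul_mem_valueSpace_quasiPfister l (apply_mem_valueSpace _ _) (apply_mem_valueSpace _ _))
  have h0 : s 0 = 0 := by
    rw [h1, QuasilinearForm.map_zero, mul_zero, add_zero] at h
    exact hl _ h
  have := hs
  rw [Fin.sum_univ_two, h0, h1] at this
  rw [this, TensorProduct.tmul_zero, TensorProduct.tmul_zero, add_zero]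
  rfl

/-- Every finite extension `E` of `K ^ 2` inside `K` is the set of values of an anisotropic
quasi-Pfister form: adjoin elements of `E` one at a time. -/
theorem exists_quasiPfister_valueSpace_eq (E : IntermediateField (squares K) K)
    [FiniteDimensional (squares K) E] :
    ∃ l : List Kˣ, (quasiPfister l).form.IsAnisotropic ∧
      ∀ y, y ∈ (quasiPfister l).form.valueSpace ↔ y ∈ E := by
  by_contra! hcon
  have key : ∀ n : ℕ, ∃ l : List Kˣ, l.length = n ∧ (quasiPfister l).form.IsAnisotropic ∧
      ∀ y ∈ (quasiPfister l).form.valueSpace, y ∈ E := by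
    intro n
    induction n with
    | zero =>
      refine ⟨[], rfl, one_isAnisotropic, ?_⟩
      rintro _ ⟨(x : K), rfl⟩
      have h : x ^ 2 ∈ E := by
        rw [sq]
        exact E.algebraMap_mem ⟨_, mul_self_mem_squares x⟩
      exact h
    | succ n ih =>
      obtain ⟨l, hn, hl, hE⟩ := ih
      obtain ⟨y, hy⟩ := hcon l hl
      have hy' : y ∉ (quasiPfister l).form.valueSpace ∧ y ∈ E := by
        rcases hy with hy | hy
        · exact absurd (hE y hy.1) hy.2
        · exact hy
      have hy0 : y ≠ 0 := fun h => hy'.1 (h ▸ zero_mem _)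
      refine ⟨Units.mk0 y hy0 :: l, by simp [hn],
        quasiPfister_cons_isAnisotropic hl hy'.1, fun z hz => ?_⟩
      rw [mem_valueSpace_quasiPfister_cons] at hz
      obtain ⟨s, hs, t, ht, rfl⟩ := hz
      exact add_mem (hE s hs) (mul_mem hy'.2 (hE t ht))
  obtain ⟨l, hn, hl, hE⟩ := key (Module.finrank (squares K) E)
  have h₁ := finrank_valueSpace hl
  rw [finrank_quasiPfister, hn] at h₁
  have h₂ := Submodule.finrank_mono
    (show (quasiPfister l).form.valueSpace ≤ E.toSubalgebra.toSubmodule from hE)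
  have h₃ : Module.finrank (squares K) E.toSubalgebra.toSubmodule =
    Module.finrank (squares K) E := rfl
  have := Nat.lt_two_pow_self (n := Module.finrank (squares K) E)
  omega

/-- The field of all `x` with `x P ⊆ P`, for a `K ^ 2`-subspace `P` of `K`. It is closed under
inverses because `x⁻¹ = (x⁻¹) ^ 2 * x`. -/
def multiplierField (P : Submodule (squares K) K) : IntermediateField (squares K) K where
  carrier := {x | ∀ y ∈ P, x * y ∈ P}
  mul_mem' := fun {a b} ha hb y hy => by
    rw [mul_assoc]
    exact ha _ (hb y hy)
  add_mem' := fun {a b} ha hb y hy => by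
    rw [add_mul]
    exact add_mem (ha y hy) (hb y hy)
  algebraMap_mem' := fun c y hy => P.smul_mem c hy
  inv_mem' := fun x hx y hy => by
    have e : x⁻¹ * y = x⁻¹ * x⁻¹ * (x * y) := by
      rcases eq_or_ne x 0 with rfl | h
      · simp
      · field_simp
    rw [e]
    exact P.smul_mem (⟨_, mul_self_mem_squares x⁻¹⟩ : squares K) (hx y hy)

theorem finiteDimensional_multiplierField {P : Submodule (squares K) K}
    [Module.Finite (squares K) P]
    (hP : P ≠ ⊥) : FiniteDimensional (squares K) (multiplierField P) := by
  obtain ⟨y, hy, hy0⟩ := Submodule.exists_mem_ne_zero_of_ne_bot hP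
  let f : multiplierField P →ₗ[squares K] P :=
    { toFun := fun x => ⟨x * y, x.2 y hy⟩
      map_add' := fun a b => Subtype.ext (add_mul (a : K) b y)
      map_smul' := fun c a => Subtype.ext (smul_mul_assoc c (a : K) y) }
  refine Module.Finite.of_injective f fun a b h => Subtype.ext ?_
  exact mul_right_cancel₀ hy0 (congrArg Subtype.val h)

/-- The space `P`, as a vector space over its multiplier field. -/
def overMultiplierField (P : Submodule (squares K) K) : Submodule (multiplierField P) K where
  carrier := P
  zero_mem' := P.zero_mem
  add_mem' := P.add_mem
  smul_mem' := fun c x hx => c.2 x hx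

/-- An anisotropic form is divisible by a quasi-Pfister form whose values are the multipliers of
the value space: a basis of the value space over its multiplier field gives the other factor. -/
theorem isDivisibleBy_of_valueSpace_eq_multiplierField [Module.Finite K V]
    {q : QuasilinearForm K V} (hq : q.IsAnisotropic) {l : List Kˣ}
    (hl : (quasiPfister l).form.IsAnisotropic)
    (hE : ∀ y, y ∈ (quasiPfister l).form.valueSpace ↔ y ∈ multiplierField q.valueSpace) :
    q.IsDivisibleBy (quasiPfister l).form := by
  have hfin : Module.Finite (squares K) (overMultiplierField q.valueSpace) :=
    inferInstanceAs (Module.Finite (squares K) q.valueSpace)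
  have : Module.Finite (multiplierField q.valueSpace) (overMultiplierField q.valueSpace) :=
    Module.Finite.of_restrictScalars_finite (squares K) _ _
  have : Module.Free (multiplierField q.valueSpace) (overMultiplierField q.valueSpace) :=
    Module.Free.of_divisionRing _ _
  let e := Module.finBasis (multiplierField q.valueSpace) (overMultiplierField q.valueSpace)
  let a : Fin _ → K := fun i => (e i : K)
  refine ⟨_, diagonal K a, isIsometric_of_valueSpace_eq hq ?_ ?_⟩
  · intro t ht
    obtain ⟨s, hs, hs'⟩ := exists_tmul_diagonal_eq a (quasiPfister l).form t
    have h0 := hs'.symm.trans ht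
    have h1 := Fintype.linearIndependent_iff.1 e.linearIndependent
      (fun i => ⟨_, (hE _).1 (apply_mem_valueSpace _ (s i))⟩) (Subtype.ext (by
        rw [Submodule.coe_sum]
        exact h0))
    have h2 : ∀ i, s i = 0 := fun i => hl _ (congrArg Subtype.val (h1 i))
    rw [hs]
    simp [h2]
  · ext y
    constructor
    · intro hy
      have h := e.sum_repr ⟨y, hy⟩
      have h' : ∀ i, ∃ s, (quasiPfister l).form s = (e.repr ⟨y, hy⟩ i : K) := fun i =>
        (hE _).2 (e.repr ⟨y, hy⟩ i).2
      choose s hs using h'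
      refine ⟨∑ i, s i ⊗ₜ Pi.single i 1, ?_⟩
      rw [map_sum]
      simp only [tmul_tmul, diagonal_single, one_pow, mul_one, hs]
      have := congrArg Subtype.val h
      rwa [Submodule.coe_sum] at this
    · rintro ⟨t, rfl⟩
      obtain ⟨s, hs, hs'⟩ := exists_tmul_diagonal_eq a (quasiPfister l).form t
      rw [hs']
      exact sum_mem fun i _ => (hE _).1 (apply_mem_valueSpace _ (s i)) _ (e i).2

theorem length_le_divisibilityIndex [Module.Finite K V] {q : QuasilinearForm K V}
    (h0 : 0 < Module.finrank K (V ⧸ q.isotropicSubspace)) {l : List Kˣ}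
    (hl : q.anisotropicPart.IsDivisibleBy (quasiPfister l).form) :
    l.length ≤ q.divisibilityIndex := by
  refine le_csSup ⟨Module.finrank K (V ⧸ q.isotropicSubspace), ?_⟩ ⟨l, rfl, hl⟩
  rintro _ ⟨l, rfl, m, r, ⟨e⟩⟩
  have h := e.toLinearEquiv.finrank_eq
  rw [Module.finrank_tensorProduct, finrank_quasiPfister, Module.finrank_fin_fun] at h
  have hm : 0 < m := by
    rcases Nat.eq_zero_or_pos m with rfl | hm
    · rw [mul_zero] at h
      omega
    · exact hm
  rw [h]
  exact Nat.lt_two_pow_self.le.trans (Nat.le_mul_of_pos_right _ hm)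

end Multiplier

/-! ### Semilinear functionals on polynomials -/

section Functionals

variable {F : Type u} [Field F] [CharP F 2]

/-- An `F ^ 2`-linear map `F → F`, applied to the coefficients of a polynomial, is linear over
squares of polynomials. -/
theorem map_mul_self_mul {σ : Type*} {φ : F →+ F} (hφ : ∀ a x, φ (a * a * x) = a * a * φ x)
    (s f : MvPolynomial σ F) :
    AddMonoidAlgebra.map φ (s * s * f) = s * s * AddMonoidAlgebra.map φ f := by
  induction s using MvPolynomial.induction_on' with
  | monomial m a =>
    ext n
    rw [MvPolynomial.coeff_addMonoidAlgebraMap, MvPolynomial.monomial_mul,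
      MvPolynomial.coeff_monomial_mul', MvPolynomial.coeff_monomial_mul',
      MvPolynomial.coeff_addMonoidAlgebraMap]
    split_ifs
    · exact hφ a _
    · exact φ.map_zero
  | add s t hs ht =>
    have e : ∀ x : MvPolynomial σ F, (s + t) * (s + t) * x = s * s * x + t * t * x := fun x => by
      rw [CharTwo.add_mul_self, add_mul]
    have hadd : ∀ x y : MvPolynomial σ F, AddMonoidAlgebra.map φ (x + y) =
        AddMonoidAlgebra.map φ x + AddMonoidAlgebra.map φ y := fun x y => by
      ext n
      exact φ.map_add _ _
    rw [e, e, hadd, hs, ht]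

/-- If `b` is linearly independent over the subfield of squares and `∑ bⱼ uⱼ ^ 2` is divisible by
`P ^ 2`, then each `uⱼ ^ 2` is. -/
theorem sq_dvd_of_sq_dvd_sum {σ ι : Type*} [Fintype ι] {b : ι → F}
    (hb : LinearIndependent (squares F) b) {u : ι → MvPolynomial σ F} {P : MvPolynomial σ F}
    (h : P ^ 2 ∣ ∑ j, MvPolynomial.C (b j) * u j ^ 2) (j : ι) : P ^ 2 ∣ u j ^ 2 := by
  classical
  obtain ⟨β, hβ⟩ := (Fintype.linearCombination (squares F) b).exists_leftInverse_of_injective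
    (LinearMap.ker_eq_bot.2 hb.fintypeLinearCombination_injective)
  let φ : F →+ F := AddMonoidHom.mk' (fun x => (β x j : F)) (fun x y => by simp)
  have hφ : ∀ a x, φ (a * a * x) = a * a * φ x := fun a x => by
    have := β.map_smul ⟨_, mul_self_mem_squares a⟩ x
    exact congrArg (fun y : squares F => (y : F)) (congrFun this j)
  have hφb : ∀ l, φ (b l) = if l = j then 1 else 0 := fun l => by
    have := LinearMap.congr_fun hβ (Pi.single l 1)
    simp only [LinearMap.comp_apply, Fintype.linearCombination_apply_single, one_smul,
      LinearMap.id_apply] at this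
    change ((β (b l) j : squares F) : F) = _
    rw [this, Pi.single_apply]
    simp only [eq_comm (a := j)]
    split_ifs <;> rfl
  have hsum : ∀ (s : Finset ι) (f : ι → MvPolynomial σ F),
      AddMonoidAlgebra.map φ (∑ i ∈ s, f i) = ∑ i ∈ s, AddMonoidAlgebra.map φ (f i) := by
    intro s f
    ext n
    rw [MvPolynomial.coeff_addMonoidAlgebraMap, MvPolynomial.coeff_sum, MvPolynomial.coeff_sum,
      _root_.map_sum]
    rfl
  have hC : ∀ l, AddMonoidAlgebra.map φ (MvPolynomial.C (b l) : MvPolynomial σ F) =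
      MvPolynomial.C (if l = j then 1 else 0) := fun l => by
    rw [← hφb]
    ext n
    rw [MvPolynomial.coeff_addMonoidAlgebraMap, MvPolynomial.coeff_C, MvPolynomial.coeff_C]
    split_ifs <;> simp
  obtain ⟨f, hf⟩ := h
  refine ⟨AddMonoidAlgebra.map φ f, ?_⟩
  have := congrArg (AddMonoidAlgebra.map φ) hf
  rw [sq P, map_mul_self_mul hφ, hsum, Finset.sum_eq_single j] at this
  · rwa [mul_comm, sq (u j), map_mul_self_mul hφ, hC, if_pos rfl, _root_.map_one, mul_one,
      ← sq, ← sq P] at this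
  · intro l _ hl
    rw [mul_comm, sq, map_mul_self_mul hφ, hC, if_neg hl, _root_.map_zero, mul_zero]
  · simp

end Functionals

/-! ### Derivations of the function field of the cone -/

section Cone

variable {F : Type u} [Field F] {V : Type v} [AddCommGroup V] [Module F V] [Module.Finite F V]

/-- The map sending a polynomial to the function which it defines on the affine cone `{p = 0}`. -/
def toCone (p : QuasilinearForm F V) :
    MvPolynomial (Fin (Module.finrank F V)) F →ₐ[F] p.ConeFunctionField :=
  (IsScalarTower.toAlgHom F p.CoordinateRing p.ConeFunctionField).comp
    (Ideal.Quotient.mkₐ F p.coneIdeal)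

theorem toCone_X (p : QuasilinearForm F V) (i : Fin (Module.finrank F V)) :
    p.toCone (MvPolynomial.X i) = p.coordinate i := rfl

theorem toCone_eq_zero_iff {p : QuasilinearForm F V} (hp : p.IsAnisotropic) (hdim : 2 ≤ p.dim)
    (f : MvPolynomial (Fin (Module.finrank F V)) F) : p.toCone f = 0 ↔ p.polynomial ∣ f := by
  change algebraMap p.CoordinateRing p.ConeFunctionField (Ideal.Quotient.mk p.coneIdeal f) = 0 ↔ _
  rw [IsFractionRing.to_map_eq_zero_iff, Ideal.Quotient.eq_zero_iff_mem, coneIdeal_eq p hp hdim,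
    Ideal.mem_span_singleton]

theorem exists_common_denominator (p : QuasilinearForm F V) {ι : Type*} [Finite ι]
    (z : ι → p.ConeFunctionField) :
    ∃ (h : MvPolynomial (Fin (Module.finrank F V)) F)
      (u : ι → MvPolynomial (Fin (Module.finrank F V)) F),
      p.toCone h ≠ 0 ∧ ∀ j, p.toCone (u j) = p.toCone h * z j := by
  obtain ⟨⟨a, ha⟩, h⟩ := IsLocalization.exist_integer_multiples_of_finite
    (nonZeroDivisors p.CoordinateRing) z
  obtain ⟨h', rfl⟩ := Ideal.Quotient.mk_surjective a
  choose r hr using h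
  choose u hu using fun j => Ideal.Quotient.mk_surjective (r j)
  refine ⟨h', u, ?_, fun j => ?_⟩
  · exact fun h0 => nonZeroDivisors.ne_zero ha (IsFractionRing.to_map_eq_zero_iff.1 h0)
  · change algebraMap p.CoordinateRing p.ConeFunctionField (Ideal.Quotient.mk p.coneIdeal (u j)) = _
    rw [hu, hr]
    exact Algebra.smul_def _ _

theorem toCone_polynomial {p : QuasilinearForm F V} (hp : p.IsAnisotropic) (hdim : 2 ≤ p.dim) :
    ∑ j, algebraMap F p.ConeFunctionField (p (Module.finBasis F V j)) * p.coordinate j ^ 2 = 0 := by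
  have h := (toCone_eq_zero_iff hp hdim _).2 dvd_rfl
  rw [polynomial, _root_.map_sum] at h
  rw [← h]
  refine Finset.sum_congr rfl fun j _ => ?_
  rw [_root_.map_mul, map_pow, toCone_X]
  congr 1

theorem coordinate_ne_zero {p : QuasilinearForm F V} (hp : p.IsAnisotropic) (hdim : 2 ≤ p.dim)
    (i : Fin (Module.finrank F V)) : p.coordinate i ≠ 0 := by
  rw [← toCone_X, Ne, toCone_eq_zero_iff hp hdim]
  intro h
  have hd := MvPolynomial.totalDegree_le_of_dvd_of_isDomain h (MvPolynomial.X_ne_zero i)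
  rw [p.polynomial_isHomogeneous.totalDegree (p.polynomial_irreducible hp hdim).ne_zero,
    MvPolynomial.totalDegree_X] at hd
  omega

variable [CharP F 2]

instance charP_coneFunctionField (p : QuasilinearForm F V) : CharP p.ConeFunctionField 2 :=
  charP_of_injective_algebraMap (algebraMap F p.ConeFunctionField).injective 2

/-- The partial derivative in the direction of a coordinate kills the equation of the cone, because
this is a polynomial in squares; so it induces a derivation of the function field. The derivation
is constructed as a ring homomorphism to the dual numbers. -/
theorem exists_derivation {p : QuasilinearForm F V} (hp : p.IsAnisotropic) (hdim : 2 ≤ p.dim)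
    (i : Fin (Module.finrank F V)) :
    ∃ D : Derivation F p.ConeFunctionField p.ConeFunctionField,
      ∀ j, D (p.coordinate j) = if j = i then 1 else 0 := by
  let L := p.ConeFunctionField
  let τ₀ : MvPolynomial (Fin (Module.finrank F V)) F →ₐ[F] DualNumber L :=
    MvPolynomial.aeval fun j => TrivSqZeroExt.inl (p.coordinate j) +
      TrivSqZeroExt.inr (if j = i then 1 else 0)
  have hfst₀ : ∀ f, (τ₀ f).fst = p.toCone f := by
    intro f
    have : (TrivSqZeroExt.fstHom F L L).comp τ₀ = p.toCone := by
      ext j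
      simp only [AlgHom.comp_apply, τ₀, MvPolynomial.aeval_X, TrivSqZeroExt.fstHom_apply,
        TrivSqZeroExt.fst_add, TrivSqZeroExt.fst_inl, TrivSqZeroExt.fst_inr, add_zero]
      rfl
    exact AlgHom.congr_fun this f
  have hτ₀ : ∀ f ∈ p.coneIdeal, τ₀ f = 0 := by
    intro f hf
    rw [coneIdeal_eq p hp hdim, Ideal.mem_span_singleton] at hf
    obtain ⟨g, rfl⟩ := hf
    have h0 : τ₀ p.polynomial = 0 := by
      ext
      · exact (hfst₀ _).trans ((toCone_eq_zero_iff hp hdim _).2 dvd_rfl)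
      · rw [polynomial, _root_.map_sum, TrivSqZeroExt.snd_sum]
        refine Finset.sum_eq_zero fun j _ => ?_
        rw [_root_.map_mul, map_pow, ← MvPolynomial.algebraMap_eq, AlgHom.commutes,
          ← Algebra.smul_def, TrivSqZeroExt.snd_smul, TrivSqZeroExt.snd_pow, two_nsmul,
          CharTwo.add_self_eq_zero, smul_zero]
    rw [_root_.map_mul, h0, zero_mul]
  let τ₁ : p.CoordinateRing →ₐ[F] DualNumber L := Ideal.Quotient.liftₐ p.coneIdeal τ₀ hτ₀
  have hfst₁ : ∀ f, (τ₁ f).fst = algebraMap p.CoordinateRing L f := by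
    intro f
    obtain ⟨f, rfl⟩ := Ideal.Quotient.mk_surjective f
    exact hfst₀ f
  have hunit : ∀ y : nonZeroDivisors p.CoordinateRing, IsUnit (τ₁ y) := by
    intro y
    rw [TrivSqZeroExt.isUnit_iff_isUnit_fst, hfst₁, isUnit_iff_ne_zero, Ne,
      IsFractionRing.to_map_eq_zero_iff]
    exact nonZeroDivisors.ne_zero y.2
  let τ : L →ₐ[F] DualNumber L := IsLocalization.liftAlgHom (M := nonZeroDivisors p.CoordinateRing)
    (f := τ₁) hunit
  have hτ : ∀ f, τ (algebraMap p.CoordinateRing L f) = τ₁ f := fun f =>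
    IsLocalization.lift_eq hunit f
  have hfst : ∀ z, (τ z).fst = z := by
    intro z
    obtain ⟨a, b, hb, rfl⟩ := IsFractionRing.div_surjective (A := p.CoordinateRing) z
    have hb' : algebraMap p.CoordinateRing L b ≠ 0 := by
      rw [Ne, IsFractionRing.to_map_eq_zero_iff]
      exact nonZeroDivisors.ne_zero hb
    have h := congrArg TrivSqZeroExt.fst (congrArg τ
      (div_mul_cancel₀ (algebraMap p.CoordinateRing L a) hb'))
    rw [_root_.map_mul, TrivSqZeroExt.fst_mul, hτ, hτ, hfst₁, hfst₁] at h
    rw [eq_div_iff hb', h]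
  refine ⟨Derivation.mk' ((TrivSqZeroExt.sndHom L L).restrictScalars F ∘ₗ τ.toLinearMap)
    fun a b => ?_, fun j => ?_⟩
  · change (τ (a * b)).snd = a • (τ b).snd + b • (τ a).snd
    rw [_root_.map_mul, TrivSqZeroExt.snd_mul, hfst, hfst, op_smul_eq_smul]
  · change (τ (algebraMap p.CoordinateRing L (Ideal.Quotient.mk p.coneIdeal (MvPolynomial.X j)))).snd
      = _
    rw [hτ]
    change (τ₀ (MvPolynomial.X j)).snd = _
    simp only [τ₀, MvPolynomial.aeval_X, TrivSqZeroExt.snd_add, TrivSqZeroExt.snd_inl,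
      TrivSqZeroExt.snd_inr, zero_add]

/-- The derivation `∂ / ∂Xᵢ` of the function field of the cone `{p = 0}`. -/
def coneDerivation {p : QuasilinearForm F V} (hp : p.IsAnisotropic) (hdim : 2 ≤ p.dim)
    (i : Fin (Module.finrank F V)) : Derivation F p.ConeFunctionField p.ConeFunctionField :=
  (exists_derivation hp hdim i).choose

theorem coneDerivation_coordinate {p : QuasilinearForm F V} (hp : p.IsAnisotropic)
    (hdim : 2 ≤ p.dim) (i j : Fin (Module.finrank F V)) :
    coneDerivation hp hdim i (p.coordinate j) = if j = i then 1 else 0 :=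
  (exists_derivation hp hdim i).choose_spec j

open Polynomial in
/-- The comparison of second order Taylor coefficients: if `∑ bⱼ uⱼ ^ 2 = p g`, then the terms of
degree `2` of both sides at `X + Y eᵢ` are, on the cone, `∑ bⱼ (∂ᵢ uⱼ) ^ 2` and `p(eᵢ) g`. -/
theorem sum_coneDerivation_sq_of_eq_mul {p : QuasilinearForm F V} (hp : p.IsAnisotropic)
    (hdim : 2 ≤ p.dim) {ι : Type*} [Fintype ι] (b : ι → F)
    {u : ι → MvPolynomial (Fin (Module.finrank F V)) F}
    {g : MvPolynomial (Fin (Module.finrank F V)) F}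
    (h : ∑ j, MvPolynomial.C (b j) * u j ^ 2 = p.polynomial * g) (i : Fin (Module.finrank F V)) :
    ∑ j, algebraMap F p.ConeFunctionField (b j) *
        coneDerivation hp hdim i (p.toCone (u j)) ^ 2 =
      algebraMap F p.ConeFunctionField (p (Module.finBasis F V i)) * p.toCone g := by
  let T : MvPolynomial (Fin (Module.finrank F V)) F →ₐ[F] p.ConeFunctionField[X] :=
    MvPolynomial.aeval fun j => C (p.coordinate j) + C (if j = i then 1 else 0) * X
  have hTC : ∀ a, T (MvPolynomial.C a) = C (algebraMap F _ a) := fun a => T.commutes a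
  have hT0 : ∀ f, (T f).coeff 0 = p.toCone f := by
    intro f
    induction f using MvPolynomial.induction_on with
    | C a =>
      rw [hTC, coeff_C_zero]
      exact (p.toCone.commutes a).symm
    | add f g hf hg => rw [_root_.map_add, coeff_add, hf, hg, _root_.map_add]
    | mul_X f j hf =>
      rw [_root_.map_mul, mul_coeff_zero, hf, _root_.map_mul, toCone_X]
      simp only [T, MvPolynomial.aeval_X, coeff_add, coeff_C_zero, coeff_C_mul, coeff_X_zero,
        mul_zero, add_zero]
  have hT1 : ∀ f, (T f).coeff 1 = coneDerivation hp hdim i (p.toCone f) := by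
    intro f
    induction f using MvPolynomial.induction_on with
    | C a =>
      rw [hTC, coeff_C_succ]
      exact ((congrArg _ (p.toCone.commutes a)).trans
        ((coneDerivation hp hdim i).map_algebraMap a)).symm
    | add f g hf hg => simp only [_root_.map_add, coeff_add, hf, hg]
    | mul_X f j hf =>
      rw [_root_.map_mul, mul_coeff_one, hf, hT0, _root_.map_mul, toCone_X, Derivation.leibniz,
        coneDerivation_coordinate]
      simp only [T, MvPolynomial.aeval_X, coeff_add, coeff_C_zero, coeff_C_mul, coeff_X_zero,
        coeff_X_one, coeff_C_succ, smul_eq_mul]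
      ring
  have hsq : ∀ f : p.ConeFunctionField[X], (f ^ 2).coeff 2 = f.coeff 1 ^ 2 := by
    intro f
    rw [sq, coeff_mul, Finset.Nat.antidiagonal_eq_map]
    simp only [Finset.sum_map, Finset.sum_range_succ, Finset.sum_range_zero]
    have := CharTwo.add_self_eq_zero (f.coeff 0 * f.coeff 2)
    linear_combination this
  have hTp : T p.polynomial = C (algebraMap F _ (p (Module.finBasis F V i))) * X ^ 2 := by
    have e : ∀ j, T (MvPolynomial.C (p (Module.finBasis F V j)) * MvPolynomial.X j ^ 2) =
        C (algebraMap F _ (p (Module.finBasis F V j)) * p.coordinate j ^ 2) +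
        if j = i then C (algebraMap F _ (p (Module.finBasis F V j))) * X ^ 2 else 0 := by
      intro j
      rw [_root_.map_mul, map_pow, hTC]
      simp only [T, MvPolynomial.aeval_X]
      rw [CharTwo.add_sq]
      split_ifs <;> simp [mul_add]
    rw [polynomial, _root_.map_sum, Finset.sum_congr rfl fun j _ => e j, Finset.sum_add_distrib,
      ← _root_.map_sum, toCone_polynomial hp hdim, _root_.map_zero, zero_add]
    simp
  have h' := congrArg (fun f => (T f).coeff 2) h
  simp only [_root_.map_sum, _root_.map_mul, map_pow, hTC, hTp, finsetSum_coeff, coeff_C_mul,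
    hsq, hT1] at h'
  rw [h', mul_assoc, coeff_C_mul, mul_comm (X ^ 2), coeff_mul_X_pow' , if_pos le_rfl, Nat.sub_self,
    hT0]

/-- For an isotropic vector `z` of `⟨b₁, b₂, …⟩` over the function field of the cone, the values at
the derivatives of `z` are proportional to the coefficients of `p`. The factor vanishes only for
`z = 0`, if the form is anisotropic over the base field. -/
theorem exists_sum_coneDerivation_sq {p : QuasilinearForm F V} (hp : p.IsAnisotropic)
    (hdim : 2 ≤ p.dim) {ι : Type*} [Fintype ι] {b : ι → F} (hb : LinearIndependent (squares F) b)
    {z : ι → p.ConeFunctionField} (hz : ∑ j, algebraMap F _ (b j) * z j ^ 2 = 0) :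
    ∃ g : p.ConeFunctionField, (g = 0 → z = 0) ∧ ∀ i,
      ∑ j, algebraMap F _ (b j) * coneDerivation hp hdim i (z j) ^ 2 =
        algebraMap F _ (p (Module.finBasis F V i)) * g := by
  obtain ⟨h, u, hh, hu⟩ := p.exists_common_denominator z
  have hdvd : p.polynomial ∣ ∑ j, MvPolynomial.C (b j) * u j ^ 2 := by
    rw [← toCone_eq_zero_iff hp hdim, _root_.map_sum, ← mul_zero (p.toCone h ^ 2), ← hz,
      Finset.mul_sum]
    refine Finset.sum_congr rfl fun j _ => ?_
    rw [_root_.map_mul, map_pow, hu, ← MvPolynomial.algebraMap_eq, p.toCone.commutes]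
    ring
  obtain ⟨g, hg⟩ := hdvd
  refine ⟨p.toCone g / p.toCone h ^ 2, fun h0 => ?_, fun i => ?_⟩
  · have h1 : p.toCone g = 0 := by
      rcases div_eq_zero_iff.1 h0 with h1 | h1
      · exact h1
      · exact absurd (pow_eq_zero_iff two_ne_zero |>.1 h1) hh
    rw [toCone_eq_zero_iff hp hdim] at h1
    obtain ⟨f, rfl⟩ := h1
    have hprime := (p.polynomial_irreducible hp hdim).prime
    funext j
    have hj : p.polynomial ∣ u j := hprime.dvd_of_dvd_pow
      ((dvd_pow_self _ two_ne_zero).trans (sq_dvd_of_sq_dvd_sum hb ⟨f, by rw [hg]; ring⟩ j))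
    rw [← toCone_eq_zero_iff hp hdim, hu] at hj
    exact (mul_eq_zero.1 hj).resolve_left hh
  · have key := sum_coneDerivation_sq_of_eq_mul hp hdim b hg i
    have e : ∀ j, coneDerivation hp hdim i (p.toCone (u j)) ^ 2 =
        p.toCone h ^ 2 * coneDerivation hp hdim i (z j) ^ 2 +
          coneDerivation hp hdim i (p.toCone h) ^ 2 * z j ^ 2 := by
      intro j
      rw [hu, Derivation.leibniz, CharTwo.add_sq, smul_eq_mul, smul_eq_mul]
      ring
    have e' : ∑ j, algebraMap F p.ConeFunctionField (b j) *
          coneDerivation hp hdim i (p.toCone (u j)) ^ 2 =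
        p.toCone h ^ 2 *
          ∑ j, algebraMap F _ (b j) * coneDerivation hp hdim i (z j) ^ 2 := by
      rw [← add_zero (p.toCone h ^ 2 * _),
        ← mul_zero (coneDerivation hp hdim i (p.toCone h) ^ 2), ← hz, Finset.mul_sum,
        Finset.mul_sum, ← Finset.sum_add_distrib]
      exact Finset.sum_congr rfl fun j _ => by rw [e]; ring
    rw [e'] at key
    rw [mul_div_assoc', eq_div_iff (pow_ne_zero 2 hh), mul_comm, key]

end Cone

/-! ### Derivations of the function field of the quadric -/

section FunctionFieldDerivation

variable {F : Type u} [Field F] [CharP F 2] {V : Type v} [AddCommGroup V] [Module F V]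
  [Module.Finite F V] {W : Type w} [AddCommGroup W] [Module F W] [Module.Finite F W]

omit [CharP F 2] in
/-- The inclusion of the function field of the quadric in that of the affine cone. -/
def toConeFunctionField (p : QuasilinearForm F V) : p.FunctionField →ₐ[F] p.ConeFunctionField :=
  p.functionSubfield.val

omit [CharP F 2] in
theorem toConeFunctionField_injective (p : QuasilinearForm F V) :
    Function.Injective p.toConeFunctionField := p.toConeFunctionField.toRingHom.injective

/-- The derivation `Xₒ ∂ / ∂Xᵢ` has degree `0`, so it preserves the functions of degree `0`. -/
theorem coordinate_mul_coneDerivation_mem {p : QuasilinearForm F V} (hp : p.IsAnisotropic)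
    (hdim : 2 ≤ p.dim) (o i : Fin (Module.finrank F V)) {x : p.ConeFunctionField}
    (hx : x ∈ p.functionSubfield) :
    p.coordinate o * coneDerivation hp hdim i x ∈ p.functionSubfield := by
  have hgen : ∀ k l, p.coordinate k / p.coordinate l ∈ p.functionSubfield := fun k l =>
    IntermediateField.subset_adjoin F _ ⟨k, l, rfl⟩
  induction hx using IntermediateField.adjoin_induction with
  | mem x hx =>
    obtain ⟨k, l, rfl⟩ := hx
    have hl := coordinate_ne_zero hp hdim l
    have e : p.coordinate o * coneDerivation hp hdim i (p.coordinate k / p.coordinate l) =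
        p.coordinate o / p.coordinate l * (if k = i then 1 else 0) -
          p.coordinate o / p.coordinate l * (p.coordinate k / p.coordinate l) *
            (if l = i then 1 else 0) := by
      rw [Derivation.leibniz_div, coneDerivation_coordinate, coneDerivation_coordinate]
      simp only [smul_eq_mul]
      field_simp
    rw [e]
    refine sub_mem (mul_mem (hgen _ _) ?_) (mul_mem (mul_mem (hgen _ _) (hgen _ _)) ?_) <;>
      split_ifs <;> first | exact one_mem _ | exact zero_mem _
  | algebraMap a =>
    rw [Derivation.map_algebraMap, mul_zero]
    exact zero_mem _
  | add x y _ _ hx hy =>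
    rw [_root_.map_add, mul_add]
    exact add_mem hx hy
  | inv x hx' hx =>
    have e : p.coordinate o * coneDerivation hp hdim i x⁻¹ =
        -(x⁻¹ ^ 2 * (p.coordinate o * coneDerivation hp hdim i x)) := by
      rw [Derivation.leibniz_inv, smul_eq_mul]
      ring
    rw [e]
    exact neg_mem (mul_mem (pow_mem (inv_mem hx') 2) hx)
  | mul x y hx' hy' hx hy =>
    have e : p.coordinate o * coneDerivation hp hdim i (x * y) =
        x * (p.coordinate o * coneDerivation hp hdim i y) +
          y * (p.coordinate o * coneDerivation hp hdim i x) := by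
      rw [Derivation.leibniz, smul_eq_mul, smul_eq_mul]
      ring
    rw [e]
    exact add_mem (mul_mem hx' hy) (mul_mem hy' hx)

/-- The derivation `Xₒ ∂ / ∂Xᵢ` of the function field of the quadric. -/
def quadricDerivation {p : QuasilinearForm F V} (hp : p.IsAnisotropic) (hdim : 2 ≤ p.dim)
    (o i : Fin (Module.finrank F V)) (x : p.FunctionField) : p.FunctionField :=
  ⟨p.coordinate o * coneDerivation hp hdim i (p.toConeFunctionField x),
    coordinate_mul_coneDerivation_mem hp hdim o i
      (Subtype.property (p := (· ∈ p.functionSubfield)) x)⟩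

theorem toConeFunctionField_quadricDerivation {p : QuasilinearForm F V} (hp : p.IsAnisotropic)
    (hdim : 2 ≤ p.dim) (o i : Fin (Module.finrank F V)) (x : p.FunctionField) :
    p.toConeFunctionField (quadricDerivation hp hdim o i x) =
      p.coordinate o * coneDerivation hp hdim i (p.toConeFunctionField x) := rfl

theorem quadricDerivation_add {p : QuasilinearForm F V} (hp : p.IsAnisotropic)
    (hdim : 2 ≤ p.dim) (o i : Fin (Module.finrank F V)) (x y : p.FunctionField) :
    quadricDerivation hp hdim o i (x + y) =
      quadricDerivation hp hdim o i x + quadricDerivation hp hdim o i y :=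
  p.toConeFunctionField_injective (by
    simp only [_root_.map_add, toConeFunctionField_quadricDerivation, mul_add])

theorem quadricDerivation_mul {p : QuasilinearForm F V} (hp : p.IsAnisotropic)
    (hdim : 2 ≤ p.dim) (o i : Fin (Module.finrank F V)) (x y : p.FunctionField) :
    quadricDerivation hp hdim o i (x * y) =
      x * quadricDerivation hp hdim o i y + y * quadricDerivation hp hdim o i x :=
  p.toConeFunctionField_injective (by
    simp only [_root_.map_add, _root_.map_mul, toConeFunctionField_quadricDerivation,
      Derivation.leibniz, smul_eq_mul]
    ring)

/-- The proportionality of `exists_sum_coneDerivation_sq` in degree `0`, that is, over the function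
field of the quadric instead of the cone. -/
theorem sum_quadricDerivation_sq {p : QuasilinearForm F V} (hp : p.IsAnisotropic)
    (hdim : 2 ≤ p.dim) (o : Fin (Module.finrank F V)) {ι : Type*} [Fintype ι] {b : ι → F}
    (hb : LinearIndependent (squares F) b)
    {z : ι → p.FunctionField} (hz : ∑ j, algebraMap F _ (b j) * z j ^ 2 = 0) :
    (∑ j, algebraMap F _ (b j) * quadricDerivation hp hdim o o (z j) ^ 2 = 0 → z = 0) ∧ ∀ i,
      algebraMap F _ (p (Module.finBasis F V o)) *
          ∑ j, algebraMap F _ (b j) * quadricDerivation hp hdim o i (z j) ^ 2 =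
        algebraMap F _ (p (Module.finBasis F V i)) *
          ∑ j, algebraMap F _ (b j) * quadricDerivation hp hdim o o (z j) ^ 2 := by
  have hz' : ∑ j, algebraMap F p.ConeFunctionField (b j) * p.toConeFunctionField (z j) ^ 2 = 0 := by
    have := congrArg p.toConeFunctionField hz
    simpa only [_root_.map_sum, _root_.map_mul, map_pow, AlgHom.commutes, _root_.map_zero] using this
  obtain ⟨g, hg, h⟩ := exists_sum_coneDerivation_sq hp hdim hb hz'
  have h' : ∀ i, p.toConeFunctionField
      (∑ j, algebraMap F _ (b j) * quadricDerivation hp hdim o i (z j) ^ 2) =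
        p.coordinate o ^ 2 * (algebraMap F _ (p (Module.finBasis F V i)) * g) := by
    intro i
    simp only [_root_.map_sum, _root_.map_mul, map_pow, AlgHom.commutes,
      toConeFunctionField_quadricDerivation]
    rw [← h i, Finset.mul_sum]
    exact Finset.sum_congr rfl fun j _ => by ring
  refine ⟨fun h0 => ?_, fun i => p.toConeFunctionField_injective ?_⟩
  · have h1 := h' o
    rw [h0, _root_.map_zero, eq_comm] at h1
    have ho : algebraMap F p.ConeFunctionField (p (Module.finBasis F V o)) ≠ 0 := by
      rw [Ne, map_eq_zero]
      exact fun h => (Module.finBasis F V).ne_zero o (hp _ h)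
    have h2 := hg (((mul_eq_zero.1 h1).resolve_left
      (pow_ne_zero 2 (coordinate_ne_zero hp hdim o))) |> mul_eq_zero.1 |>.resolve_left ho)
    funext j
    exact (map_eq_zero p.toConeFunctionField).1 (congrFun h2 j)
  · rw [_root_.map_mul, _root_.map_mul, h', h', AlgHom.commutes, AlgHom.commutes]
    ring

/-! ### Isotropic vectors over the function field -/

omit [Module.Finite F W] in
theorem linearIndependent_apply_basis {q : QuasilinearForm F W} (hq : q.IsAnisotropic)
    {ι : Type*} [Fintype ι] (B : Module.Basis ι F W) :
    LinearIndependent (squares F) fun j => q (B j) := by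
  rw [Fintype.linearIndependent_iff]
  intro c hc
  choose a ha using fun j => exists_mul_self_eq (c j)
  have h : q (∑ j, a j • B j) = 0 := by
    rw [map_sum, ← hc]
    exact Finset.sum_congr rfl fun j _ => by rw [q.map_smul, Subfield.smul_def, ha, smul_eq_mul]
  have h' := Fintype.linearIndependent_iff.1 B.linearIndependent a (hq _ h)
  exact fun j => Subtype.ext (by rw [ha, h', mul_zero]; rfl)

omit [CharP F 2] [Module.Finite F W] in
theorem baseChange_apply_eq_sum (L : Type*) [Field L] [Algebra F L] (q : QuasilinearForm F W)
    {ι : Type*} [Fintype ι] (B : Module.Basis ι F W) (t : L ⊗[F] W) :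
    q.baseChange L t = ∑ j, algebraMap F L (q (B j)) * (B.baseChange L).repr t j ^ 2 := by
  conv_lhs => rw [← (B.baseChange L).sum_repr t]
  rw [map_sum]
  refine Finset.sum_congr rfl fun j _ => ?_
  rw [QuasilinearForm.map_smul, Module.Basis.baseChange_apply, baseChange_tmul]
  ring

/-- The form `u ↦ q(Xₒ ∂u / ∂Xₒ) / p(eₒ)` on the space of isotropic vectors of `q` over the function
field of the quadric `{p = 0}`. Its value at `u` is `Xₒ ^ 2 g` for the factor `g` in an equation
`q(u) = p g`; so it depends on `o` only through the factor `Xₒ ^ 2`, which makes its degree `0`. -/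
def isotropyMultiplier {p : QuasilinearForm F V} (hp : p.IsAnisotropic) (hdim : 2 ≤ p.dim)
    (o : Fin (Module.finrank F V)) (q : QuasilinearForm F W) :
    QuasilinearForm p.FunctionField (q.baseChange p.FunctionField).isotropicSubspace :=
  ofAddMonoidHom
    (AddMonoidHom.mk' (fun u => (algebraMap F _ (p (Module.finBasis F V o)))⁻¹ *
      ∑ j, algebraMap F _ (q (Module.finBasis F W j)) * quadricDerivation hp hdim o o
        (((Module.finBasis F W).baseChange p.FunctionField).repr u j) ^ 2)
      (fun x y => by
        rw [← mul_add, ← Finset.sum_add_distrib]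
        congr 1
        refine Finset.sum_congr rfl fun j _ => ?_
        rw [Submodule.coe_add, _root_.map_add, Finsupp.add_apply, quadricDerivation_add,
          CharTwo.add_sq, mul_add]))
    (fun a x => by
      have hx : q.baseChange p.FunctionField (x : p.FunctionField ⊗[F] W) = 0 := x.2
      rw [baseChange_apply_eq_sum _ _ (Module.finBasis F W)] at hx
      simp only [AddMonoidHom.mk'_apply, Submodule.coe_smul, _root_.map_smul, Finsupp.smul_apply,
        smul_eq_mul, quadricDerivation_mul, CharTwo.add_sq, mul_add, Finset.sum_add_distrib]
      have e : ∑ j, algebraMap F p.FunctionField (q (Module.finBasis F W j)) *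
          ((((Module.finBasis F W).baseChange p.FunctionField).repr x j) *
            quadricDerivation hp hdim o o a) ^ 2 = 0 := by
        rw [← mul_zero (quadricDerivation hp hdim o o a ^ 2), ← hx, Finset.mul_sum]
        exact Finset.sum_congr rfl fun j _ => by ring
      rw [e, mul_zero, add_zero]
      simp only [Finset.mul_sum]
      exact Finset.sum_congr rfl fun j _ => by ring)

theorem isotropyMultiplier_apply {p : QuasilinearForm F V} (hp : p.IsAnisotropic)
    (hdim : 2 ≤ p.dim) (o : Fin (Module.finrank F V)) (q : QuasilinearForm F W)
    (u : (q.baseChange p.FunctionField).isotropicSubspace) :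
    isotropyMultiplier hp hdim o q u = (algebraMap F _ (p (Module.finBasis F V o)))⁻¹ *
      ∑ j, algebraMap F _ (q (Module.finBasis F W j)) * quadricDerivation hp hdim o o
        (((Module.finBasis F W).baseChange p.FunctionField).repr u j) ^ 2 := rfl

theorem isotropyMultiplier_isAnisotropic {p : QuasilinearForm F V} (hp : p.IsAnisotropic)
    (hdim : 2 ≤ p.dim) (o : Fin (Module.finrank F V)) {q : QuasilinearForm F W}
    (hq : q.IsAnisotropic) : (isotropyMultiplier hp hdim o q).IsAnisotropic := by
  intro u hu
  have hu0 : q.baseChange p.FunctionField (u : p.FunctionField ⊗[F] W) = 0 := u.2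
  rw [baseChange_apply_eq_sum _ _ (Module.finBasis F W)] at hu0
  have ho : (algebraMap F p.FunctionField (p (Module.finBasis F V o)))⁻¹ ≠ 0 := by
    rw [Ne, inv_eq_zero, map_eq_zero]
    exact fun h => (Module.finBasis F V).ne_zero o (hp _ h)
  have h := (sum_quadricDerivation_sq hp hdim o
    (linearIndependent_apply_basis hq (Module.finBasis F W)) hu0).1
    ((mul_eq_zero.1 ((isotropyMultiplier_apply hp hdim o q u).symm.trans hu)).resolve_left ho)
  apply Subtype.ext
  rw [Submodule.coe_zero, ← ((Module.finBasis F W).baseChange p.FunctionField).repr.map_eq_zero_iff]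
  exact DFunLike.coe_injective h

/-- The multipliers of isotropic vectors of `q` map the values of `p` to values of `q`, because
`p(eᵢ) g(u) = q(∂u / ∂Xᵢ)`. -/
theorem isotropyMultiplier_mul_mem {p : QuasilinearForm F V} (hp : p.IsAnisotropic)
    (hdim : 2 ≤ p.dim) (o : Fin (Module.finrank F V)) {q : QuasilinearForm F W}
    (hq : q.IsAnisotropic) {x y : p.FunctionField}
    (hx : x ∈ (isotropyMultiplier hp hdim o q).valueSpace)
    (hy : y ∈ (p.baseChange p.FunctionField).valueSpace) :
    x * y ∈ (q.baseChange p.FunctionField).valueSpace := by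
  obtain ⟨u, rfl⟩ := hx
  obtain ⟨t, rfl⟩ := hy
  have hu0 : q.baseChange p.FunctionField (u : p.FunctionField ⊗[F] W) = 0 := u.2
  rw [baseChange_apply_eq_sum _ _ (Module.finBasis F W)] at hu0
  have ho : algebraMap F p.FunctionField (p (Module.finBasis F V o)) ≠ 0 := by
    rw [Ne, map_eq_zero]
    exact fun h => (Module.finBasis F V).ne_zero o (hp _ h)
  have h := (sum_quadricDerivation_sq hp hdim o
    (linearIndependent_apply_basis hq (Module.finBasis F W)) hu0).2
  rw [baseChange_apply_eq_sum _ p (Module.finBasis F V), isotropyMultiplier_apply, Finset.mul_sum]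
  refine sum_mem fun i _ => ?_
  set B := (Module.finBasis F W).baseChange p.FunctionField
  set a := ((Module.finBasis F V).baseChange p.FunctionField).repr t i
  refine ⟨∑ j, (a * quadricDerivation hp hdim o i (B.repr u j)) • B j, ?_⟩
  rw [map_sum, inv_mul_eq_div, div_mul_eq_mul_div, eq_div_iff ho]
  have e : ∀ j, q.baseChange p.FunctionField
      ((a * quadricDerivation hp hdim o i (B.repr u j)) • B j) =
      a ^ 2 * (algebraMap F _ (q (Module.finBasis F W j)) *
        quadricDerivation hp hdim o i (B.repr u j) ^ 2) := by
    intro j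
    rw [QuasilinearForm.map_smul, Module.Basis.baseChange_apply, baseChange_tmul]
    ring
  rw [Finset.sum_congr rfl fun j _ => e j, ← Finset.mul_sum]
  linear_combination a ^ 2 * h i

end FunctionFieldDerivation

/-! ### Counting dimensions -/

section Dimension

variable {K : Type u} [Field K] [CharP K 2]

theorem le_multiplierField {N P : Submodule (squares K) K} (hNP : ∀ x ∈ N, ∀ y ∈ P, x * y ∈ P) :
    N ≤ (multiplierField P).toSubalgebra.toSubmodule := hNP

/-- If `N P ⊆ Q` and the dimension of `Q` is less than that of `P` plus that of the multiplier field
`E` of `P`, then the spaces `x P` with `0 ≠ x ∈ N` are all equal: for `y z ∉ x P`, the sum of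
`x P` and `E y z` in `Q` would be direct. So `N` lies in a multiple of `E`. -/
theorem finrank_le_finrank_multiplierField {N P Q : Submodule (squares K) K}
    [Module.Finite (squares K) P] [Module.Finite (squares K) Q]
    (hP : P ≠ ⊥) (hN : N ≠ ⊥) (hNP : ∀ x ∈ N, ∀ y ∈ P, x * y ∈ Q)
    (hlt : Module.finrank (squares K) Q <
      Module.finrank (squares K) P + Module.finrank (squares K) (multiplierField P)) :
    Module.finrank (squares K) N ≤ Module.finrank (squares K) (multiplierField P) := by
  have := finiteDimensional_multiplierField hP
  obtain ⟨x, hx, hx0⟩ := Submodule.exists_mem_ne_zero_of_ne_bot hN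
  have key : ∀ y ∈ N, x⁻¹ * y ∈ multiplierField P := by
    intro y hy z hz
    by_contra hcon
    let f : (multiplierField P × P) →ₗ[squares K] Q :=
      { toFun := fun w => ⟨w.1 * (y * z) + x * w.2, by
          refine add_mem ?_ (hNP x hx _ w.2.2)
          rw [mul_left_comm]
          exact hNP y hy _ (w.1.2 z hz)⟩
        map_add' := fun w w' => Subtype.ext (by
          simp only [Prod.fst_add, Prod.snd_add, Submodule.coe_add, IntermediateField.coe_add]
          ring)
        map_smul' := fun c w => Subtype.ext (by
          simp only [Prod.smul_fst, Prod.smul_snd, Submodule.coe_smul, Subfield.smul_def,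
            IntermediateField.coe_smul, RingHom.id_apply, smul_eq_mul]
          ring) }
    have hf : Function.Injective f := by
      rw [injective_iff_map_eq_zero]
      rintro ⟨e, w⟩ h
      have h' : (e : K) * (y * z) + x * w = 0 := congrArg Subtype.val h
      have he : e = 0 := by
        by_contra he
        have he' : (e : K) ≠ 0 := fun h => he (Subtype.ext h)
        apply hcon
        have : x⁻¹ * y * z = -((e : K)⁻¹ * w) := by
          field_simp
          linear_combination h'
        rw [this]
        exact neg_mem ((multiplierField P).inv_mem e.2 _ w.2)
      rw [he, ZeroMemClass.coe_zero, zero_mul, zero_add] at h'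
      exact Prod.ext he (Subtype.ext ((mul_eq_zero.1 h').resolve_left hx0))
    have := LinearMap.finrank_le_finrank_of_injective hf
    rw [Module.finrank_prod] at this
    omega
  let f : N →ₗ[squares K] multiplierField P :=
    { toFun := fun y => ⟨x⁻¹ * y, key y y.2⟩
      map_add' := fun a b => Subtype.ext (mul_add x⁻¹ (a : K) b)
      map_smul' := fun c a => Subtype.ext (mul_smul_comm c x⁻¹ (a : K)) }
  refine LinearMap.finrank_le_finrank_of_injective (f := f) fun a b h => Subtype.ext ?_
  exact mul_left_cancel₀ (inv_ne_zero hx0) (congrArg Subtype.val h)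

end Dimension

section IsotropyIndex

variable {F : Type u} [Field F] [CharP F 2] {V : Type v} [AddCommGroup V] [Module F V]
  [Module.Finite F V] {W : Type w} [AddCommGroup W] [Module F W] [Module.Finite F W]

theorem finrank_valueSpace_isotropyMultiplier {p : QuasilinearForm F V} (hp : p.IsAnisotropic)
    (hdim : 2 ≤ p.dim) (o : Fin (Module.finrank F V)) {q : QuasilinearForm F W}
    (hq : q.IsAnisotropic) :
    Module.finrank (squares p.FunctionField) (isotropyMultiplier hp hdim o q).valueSpace =
      (q.baseChange p.FunctionField).isotropyIndex := by
  rw [finrank_valueSpace (isotropyMultiplier_isAnisotropic hp hdim o hq), isotropyIndex_eq_finrank]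

theorem valueSpace_baseChange_ne_bot {p : QuasilinearForm F V} (hp : p.IsAnisotropic)
    (hdim : 2 ≤ p.dim) : (p.baseChange p.FunctionField).valueSpace ≠ ⊥ := by
  intro h
  have : Nontrivial V := Module.nontrivial_of_finrank_pos (R := F) (by unfold dim at hdim; omega)
  obtain ⟨x, hx⟩ := exists_ne (0 : V)
  have h1 := (Submodule.mem_bot _).1
    (h ▸ (p.baseChange p.FunctionField).apply_mem_valueSpace (1 ⊗ₜ x))
  rw [baseChange_tmul, one_mul, one_mul, map_eq_zero] at h1
  exact hx (hp _ h1)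

theorem isotropyIndex_le_finrank_multiplierField {p : QuasilinearForm F V}
    {q : QuasilinearForm F W} (hp : p.IsAnisotropic) (hq : q.IsAnisotropic) (hdim : 2 ≤ p.dim)
    (hiso : (q.baseChange p.FunctionField).IsIsotropic)
    (hindex : (q.dim : ℤ) - (p.dim : ℤ) <
      ((q.baseChange p.FunctionField).isotropyIndex : ℤ)) :
    (q.baseChange p.FunctionField).isotropyIndex ≤ Module.finrank (squares p.FunctionField)
      (multiplierField (p.baseChange p.FunctionField).valueSpace) := by
  let o : Fin (Module.finrank F V) := ⟨0, by unfold dim at hdim; omega⟩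
  have hP := valueSpace_baseChange_ne_bot hp hdim
  have := finiteDimensional_multiplierField hP
  have hp1 : (p.baseChange p.FunctionField).isotropyIndex ≤ Module.finrank
      (squares p.FunctionField) (multiplierField (p.baseChange p.FunctionField).valueSpace) := by
    rw [← finrank_valueSpace_isotropyMultiplier hp hdim o hp]
    have : Module.Finite (squares p.FunctionField)
        (multiplierField (p.baseChange p.FunctionField).valueSpace).toSubalgebra.toSubmodule :=
      this
    exact Submodule.finrank_mono
      (le_multiplierField fun x hx y hy => isotropyMultiplier_mul_mem hp hdim o hp hx hy)
  rw [← finrank_valueSpace_isotropyMultiplier hp hdim o hq]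
  refine finrank_le_finrank_multiplierField (Q := (q.baseChange p.FunctionField).valueSpace) hP ?_
    (fun x hx y hy => isotropyMultiplier_mul_mem hp hdim o hq hx hy) ?_
  · obtain ⟨x, hx0, hx⟩ := hiso
    intro h
    have h1 := (Submodule.mem_bot _).1
      (h ▸ (isotropyMultiplier hp hdim o q).apply_mem_valueSpace ⟨x, hx⟩)
    exact hx0 (congrArg Subtype.val (isotropyMultiplier_isAnisotropic hp hdim o hq _ h1))
  · have h1 := finrank_valueSpace_add_isotropyIndex (p.baseChange p.FunctionField)
    have h2 := finrank_valueSpace_add_isotropyIndex (q.baseChange p.FunctionField)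
    rw [Module.finrank_baseChange] at h1 h2
    unfold dim at hindex
    omega

end IsotropyIndex

end QuasilinearForm
end

theorem theorem6p8 {F : Type u} [Field F] [CharP F 2]
    {V : Type v} [AddCommGroup V] [Module F V] [Module.Finite F V]
    {W : Type w} [AddCommGroup W] [Module F W] [Module.Finite F W]
    (p : QuasilinearForm F V) (q : QuasilinearForm F W)
    (hp : p.IsAnisotropic) (hq : q.IsAnisotropic)
    (hp2 : 2 ≤ p.dim) (hq2 : 2 ≤ q.dim)
    (hiso : (q.baseChange p.FunctionField).IsIsotropic)
    (hindex : (q.dim : ℤ) - (p.dim : ℤ) <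
      ((q.baseChange p.FunctionField).isotropyIndex : ℤ)) :
    (q.baseChange p.FunctionField).isotropyIndex ≤ 2 ^ p.firstDivisibilityIndex ∧
    ∃ l : List (p.FunctionField)ˣ,
      p.firstKernel.IsDivisibleBy (QuasilinearForm.quasiPfister l).form ∧
      (q.baseChange p.FunctionField).isotropyIndex ≤
        (QuasilinearForm.quasiPfister l).form.dim := by
  have hle := QuasilinearForm.isotropyIndex_le_finrank_multiplierField hp hq hp2 hiso hindex
  have hne := QuasilinearForm.valueSpace_baseChange_ne_bot hp hp2
  have hfin := QuasilinearForm.finiteDimensional_multiplierField hne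
  have han := (p.baseChange p.FunctionField).anisotropicPart_isAnisotropic
  obtain ⟨l, hl, hE⟩ := QuasilinearForm.exists_quasiPfister_valueSpace_eq
    (QuasilinearForm.multiplierField (p.baseChange p.FunctionField).valueSpace)
  have hdim : Module.finrank (QuasilinearForm.squares p.FunctionField)
      (QuasilinearForm.multiplierField (p.baseChange p.FunctionField).valueSpace) =
      2 ^ l.length := by
    rw [← QuasilinearForm.finrank_quasiPfister, ← QuasilinearForm.finrank_valueSpace hl,
      show (QuasilinearForm.quasiPfister l).form.valueSpace = (QuasilinearForm.multiplierField
        (p.baseChange p.FunctionField).valueSpace).toSubalgebra.toSubmodule from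
        Submodule.ext hE]
    rfl
  rw [hdim] at hle
  have hval : p.firstKernel.valueSpace = (p.baseChange p.FunctionField).valueSpace :=
    QuasilinearForm.valueSpace_anisotropicPart _
  have hval' : p.firstKernel.anisotropicPart.valueSpace =
      (p.baseChange p.FunctionField).valueSpace :=
    (QuasilinearForm.valueSpace_anisotropicPart _).trans hval
  have han' := p.firstKernel.anisotropicPart_isAnisotropic
  refine ⟨hle.trans (Nat.pow_le_pow_right two_pos ?_), l, ?_, ?_⟩
  · refine QuasilinearForm.length_le_divisibilityIndex ?_
      (QuasilinearForm.isDivisibleBy_of_valueSpace_eq_multiplierField han' hl (hval' ▸ hE))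
    -- Without `p₁ ≠ 0`, the divisibility index would be the supremum of an unbounded set.
    rw [← QuasilinearForm.finrank_valueSpace han', hval']
    have := Submodule.nontrivial_iff_ne_bot.2 hne
    exact Module.finrank_pos
  · exact QuasilinearForm.isDivisibleBy_of_valueSpace_eq_multiplierField han hl (hval ▸ hE)
  · rw [QuasilinearForm.dim, QuasilinearForm.finrank_quasiPfister]
    exact hle
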